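/- Let $\mathcal X_1,\dots,\mathcal X_{n-1},\mathcal Y$ be finite-dimensional real Euclidean spaces, $n\ge 1$, $\mathcal X_n=\mathcal Y$, $0\le n_1\le n-1$, $\mathcal I_1=\{1,\dots,n_1\}$, $\mathcal I_2=\{n_1+1,\dots,n\}$. Let $\mathcal A_i:\mathcal X_i\to\mathcal Y$ $(i=1,\dots,n-1)$ be linear, $b\in\mathcal Y$, $\sigma>0$. For $i\in\mathcal I_1$ let $h_i:\mathcal X_i\to\mathbb R$ be convex and twice continuously differentiable with Lipschitz continuous gradient; for $i\in\mathcal I_2$ let $h_i:\mathcal X_i\to(-\infty,+\infty]$ be proper, closed and convex. For $x=(x_1,\dots,x_{n-1})$, $x_n \in \mathcal Y$, $y=(y_i)_{i\in\mathcal I_2\setminus\{n\}}$ and $z=(z_i)_{i\in\mathcal I_2}$ put $$\mathcal L_\sigma(x,x_n,y;z)=\sum_{i\in\mathcal I_1}h_i(x_i)+\sum_{i\in\mathcal I_2\setminus\{n\}}h_i(y_i)+h_n(x_n)-\frac1{2\sigma}\sum_{i\in\mathcal I_2}\|z_i\|^2+\frac\sigma2\Big\|\sum_{i=1}^{n-1}\mathcal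 A_ix_i+x_n-b+\frac{z_n}\sigma\Big\|^2+\frac\sigma2\sum_{i\in\mathcal I_2\setminus\{n\}}\Big\|x_i-y_i-\frac{z_i}\sigma\Big\|^2,$$ and, for $w=(x,z)$, $\Phi(w)=\inf_{y,x_n}\mathcal L_\sigma(x,x_n,y;z)$ and $F(w)=(\nabla_x\Phi(w),-\nabla_z\Phi(w))$. A function $h$ is called piecewise linear-quadratic if $\operatorname{dom}h=\{h<+\infty\}$ is a union of finitely many polyhedral sets (finite intersections of closed half-spaces), on each of which $h(x)=\frac12\langle x,Qx\rangle+\langle a,x\rangle+\alpha$ for some symmetric $Q$, vector $a$ and $\alpha\in\mathbb R$. If all $h_i$, $i=1,\dots,n$, are piecewise linear-quadratic, then $\Phi$ is finite and differentiable everywhere (so $F$ is well defined), and $F$ satisfies the local error bound condition: there exist $\epsilon>0$ and $\gamma>0$ such that every $w$ with $\operatorname{dist}(w,W^*)\le\epsilon$ satisfies $$\|F(w)\|\ge\gamma\,\operatorname{dist}(w,W^*),$$ where $W^*=\{w: F(w)=0\}$ and $\operatorname{dist}$ is the Euclidean distance (the condition being vacuous if $W^*=\emptyset$). -/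

import Mathlib

open scoped InnerProductSpace

noncomputable section

namespace ConvexComposite

section ConvexFunctions

variable {E : Type*} [NormedAddCommGroup E] [InnerProductSpace ℝ E]

/-- A polyhedral set: a finite intersection of closed half-spaces. The whole space
(no half-space) and the empty set are included. -/
def IsPolyhedral (C : Set E) : Prop :=
  ∃ (m : ℕ) (a : Fin m → E) (β : Fin m → ℝ), C = {x | ∀ i, ⟪a i, x⟫_ℝ ≤ β i}

/-- An extended-real-valued function is piecewise linear-quadratic if its effective domain is the
union of finitely many polyhedral sets, relative to each of which it is given by an expression
`½⟨x, Q x⟩ + ⟨a, x⟩ + α` with `Q` symmetric. -/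
def IsPiecewiseLinearQuadratic (h : E → EReal) : Prop :=
  ∃ (K : ℕ) (C : Fin K → Set E) (Q : Fin K → E →ₗ[ℝ] E) (a : Fin K → E) (α : Fin K → ℝ),
    (∀ k, IsPolyhedral (C k)) ∧ (∀ k, (Q k).IsSymmetric) ∧
    {x | h x < ⊤} = ⋃ k, C k ∧
    ∀ k, ∀ x ∈ C k, h x = ((1 / 2 * ⟪x, Q k x⟫_ℝ + ⟪a k, x⟫_ℝ + α k : ℝ) : EReal)

/-- Proper: never `-∞` and not identically `+∞`. -/
def IsProper (h : E → EReal) : Prop :=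
  (∀ x, h x ≠ ⊥) ∧ ∃ x, h x ≠ ⊤

/-- Convexity of an extended-real-valued function: its epigraph is convex. -/
def IsConvexFun (h : E → EReal) : Prop :=
  Convex ℝ {p : E × ℝ | h p.1 ≤ (p.2 : EReal)}

/-- Proper, closed (lower semicontinuous) and convex. -/
def IsProperClosedConvex (h : E → EReal) : Prop :=
  IsProper h ∧ LowerSemicontinuous h ∧ IsConvexFun h

/-- The local error bound condition for `F`, with `W* = {u | F u = 0}`. If `W*` is empty the
condition holds trivially, both with Mathlib's `infDist w ∅ = 0` and with the convention
`dist(w, ∅) = +∞`. -/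
def LocalErrorBound (F : E → E) : Prop :=
  ∃ ε > 0, ∃ γ > 0, ∀ w : E, Metric.infDist w {u | F u = 0} ≤ ε →
    γ * Metric.infDist w {u | F u = 0} ≤ ‖F w‖

end ConvexFunctions

section Spaces

variable {n₁ m : ℕ} (X₁ : Fin n₁ → Type*) (X₂ : Fin m → Type*) (Y : Type*)
  [∀ i, NormedAddCommGroup (X₁ i)] [∀ i, InnerProductSpace ℝ (X₁ i)]
  [∀ j, NormedAddCommGroup (X₂ j)] [∀ j, InnerProductSpace ℝ (X₂ j)]
  [NormedAddCommGroup Y] [InnerProductSpace ℝ Y]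

/-- The space of `x = (x_1, …, x_{n-1})`: the smooth blocks (`Fin n₁`) followed by the nonsmooth
blocks other than the last one (`Fin m`), so `n = n₁ + m + 1`; Euclidean product structure. -/
abbrev PrimalSpace : Type _ := WithLp 2 (PiLp 2 X₁ × PiLp 2 X₂)

/-- The space of `z = (z_{n₁+1}, …, z_n)`: one multiplier for each nonsmooth block, the last one
in `Y`; Euclidean product structure. -/
abbrev DualSpace : Type _ := WithLp 2 (PiLp 2 X₂ × Y)

/-- The space of `w = (x, z)`. -/
abbrev PrimalDualSpace : Type _ := WithLp 2 (PrimalSpace X₁ X₂ × DualSpace X₂ Y)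

/-- The data of the problem
`min ∑_{i ∈ I₁} h_i(x_i) + ∑_{i ∈ I₂} h_i(x_i)  s.t.  ∑_{i<n} A_i x_i + x_n = b`.
The blocks of `I₁` are indexed by `Fin n₁`, those of `I₂ \ {n}` by `Fin m`, and the last block
lives in `Y`. -/
structure Problem where
  /-- the functions `h_i`, `i ∈ I₁` -/
  h₁ : ∀ i, X₁ i → ℝ
  /-- the functions `h_i`, `i ∈ I₂ \ {n}` -/
  h₂ : ∀ j, X₂ j → EReal
  /-- the function `h_n` -/
  hn : Y → EReal
  /-- the maps `A_i`, `i ∈ I₁` -/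
  A₁ : ∀ i, X₁ i →ₗ[ℝ] Y
  /-- the maps `A_i`, `i ∈ I₂ \ {n}` -/
  A₂ : ∀ j, X₂ j →ₗ[ℝ] Y
  /-- the right-hand side -/
  b : Y

end Spaces

namespace Problem

variable {n₁ m : ℕ} {X₁ : Fin n₁ → Type*} {X₂ : Fin m → Type*} {Y : Type*}
  [∀ i, NormedAddCommGroup (X₁ i)] [∀ i, InnerProductSpace ℝ (X₁ i)]
  [∀ j, NormedAddCommGroup (X₂ j)] [∀ j, InnerProductSpace ℝ (X₂ j)]
  [NormedAddCommGroup Y] [InnerProductSpace ℝ Y]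

/-- `∑_{i<n} A_i x_i`. -/
def linPart (P : Problem X₁ X₂ Y) (x : PrimalSpace X₁ X₂) : Y :=
  ∑ i, P.A₁ i (x.fst i) + ∑ j, P.A₂ j (x.snd j)

/-- The augmented Lagrangian `L_σ(x, x_n, y; z)`. -/
def augLagrangian (P : Problem X₁ X₂ Y) (σ : ℝ) (x : PrimalSpace X₁ X₂) (xn : Y)
    (y : PiLp 2 X₂) (z : DualSpace X₂ Y) : EReal :=
  ((∑ i, P.h₁ i (x.fst i) : ℝ) : EReal) + ∑ j, P.h₂ j (y j) + P.hn xn +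
    ((-(1 / (2 * σ)) * (∑ j, ‖z.fst j‖ ^ 2 + ‖z.snd‖ ^ 2)
      + σ / 2 * ‖P.linPart x + xn - P.b + σ⁻¹ • z.snd‖ ^ 2
      + σ / 2 * ∑ j, ‖x.snd j - y j - σ⁻¹ • z.fst j‖ ^ 2 : ℝ) : EReal)

/-- `min_{y, x_n} L_σ(x, x_n, y; z)` as an extended real number. -/
def reducedALE (P : Problem X₁ X₂ Y) (σ : ℝ) (w : PrimalDualSpace X₁ X₂ Y) : EReal :=
  ⨅ (y : PiLp 2 X₂) (xn : Y), P.augLagrangian σ w.fst xn y w.snd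

/-- The function `Φ(x; z) = min_{y, x_n} L_σ(x, x_n, y; z)`, as a real number. -/
def Phi (P : Problem X₁ X₂ Y) (σ : ℝ) (w : PrimalDualSpace X₁ X₂ Y) : ℝ :=
  (P.reducedALE σ w).toReal

variable [∀ i, FiniteDimensional ℝ (X₁ i)] [∀ j, FiniteDimensional ℝ (X₂ j)]
  [FiniteDimensional ℝ Y]

/-- The gradient of `Φ` with respect to `x`. -/
def gradX (P : Problem X₁ X₂ Y) (σ : ℝ) (w : PrimalDualSpace X₁ X₂ Y) : PrimalSpace X₁ X₂ :=
  haveI : CompleteSpace (PrimalSpace X₁ X₂) := FiniteDimensional.complete ℝ _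
  gradient (fun x : PrimalSpace X₁ X₂ => P.Phi σ (WithLp.toLp 2 (x, w.snd))) w.fst

/-- The gradient of `Φ` with respect to `z`. -/
def gradZ (P : Problem X₁ X₂ Y) (σ : ℝ) (w : PrimalDualSpace X₁ X₂ Y) : DualSpace X₂ Y :=
  haveI : CompleteSpace (DualSpace X₂ Y) := FiniteDimensional.complete ℝ _
  gradient (fun z : DualSpace X₂ Y => P.Phi σ (WithLp.toLp 2 (w.fst, z))) w.snd

/-- The residual mapping `F(w) = (∇_x Φ(w), -∇_z Φ(w))`. -/
def residual (P : Problem X₁ X₂ Y) (σ : ℝ) (w : PrimalDualSpace X₁ X₂ Y) :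
    PrimalDualSpace X₁ X₂ Y :=
  WithLp.toLp 2 (P.gradX σ w, -P.gradZ σ w)

end Problem

end ConvexComposite

end

/-!
The residual `F` is a continuous piecewise affine map, and such maps satisfy a local error bound.

*Piecewise affine maps.* Here a map is piecewise affine if it is a continuous selection of finitely
many affine maps `g`. The hyperplanes on which coordinates of two of these maps agree cut the
space into finitely many relatively open cells, and by connectedness one map `g` gives `F` on the
closure of each cell (`eq_of_mem_closed_cell`). For `w` in such a closed cell the distance to the
zeros of `F` is therefore controlled by the distance to the solutions of a finite system of affine
equations and inequalities, `g = 0` together with the description of the cell, at which the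
residual of `w` is at most `‖F w‖`. A local form of Hoffman's lemma
(`exists_errorBound_affine_system`) bounds that distance by a multiple of `‖F w‖`, or else bounds
`‖F w‖` away from zero; this gives Robinson's error bound, `IsPiecewiseAffine.localErrorBound`.

*The gradient of `Φ` is piecewise affine.* Minimization over `y` and `x_n` decouples, so `Φ` is the
sum of the smooth functions, of Moreau envelopes of the nonsmooth functions and of a quadratic,
each composed with an affine map (`Problem.exists_reducedALE_eq_coe`). For a smooth piecewise
linear-quadratic function, the union of the interiors of the pieces is dense, and on each interior
the gradient is affine (`hasPiecewiseAffineGradient_of_plq`). The Moreau envelope of `h` has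
gradient `σ (u - prox u)`.
The point `p = prox u` lies in some piece of `h`; moving from `p` along directions that keep the
active constraints of that piece active, the optimality of `p` forces first-order stationarity and
positive semidefiniteness of the quadratic form, and these conditions determine `p` as an affine
function of `u` (`isPiecewiseAffine_prox`). There are finitely many pieces and active sets, and
`prox` is nonexpansive, hence continuous. Finally `F` is the gradient of `Φ` followed by the sign
change `(x, z) ↦ (x, -z)`.
-/

namespace ConvexComposite

/-! ### Error bounds for affine systems and piecewise affine maps -/

section ErrorBound

variable {E F : Type*} [NormedAddCommGroup E] [InnerProductSpace ℝ E]
  [NormedAddCommGroup F] [InnerProductSpace ℝ F]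

/-- Error bound for a finite system of affine equations `g j = 0`, `j ∈ J`. If the system is
inconsistent, its residual is bounded below and the claim holds because no `r < δ` qualifies. -/
theorem exists_errorBound_affine_eq [FiniteDimensional ℝ E] {ι : Type*} (g : ι → E →ᵃ[ℝ] ℝ)
    (J : Finset ι) :
    ∃ κ : ℝ, 0 ≤ κ ∧ ∃ δ > 0, ∀ (x : E) (r : ℝ), 0 ≤ r → r < δ → (∀ j ∈ J, |g j x| ≤ r) →
      ∃ y, (∀ j ∈ J, g j y = 0) ∧ ‖x - y‖ ≤ κ * r := by
  let T : E →ₗ[ℝ] (J → ℝ) := LinearMap.pi fun j => (g j).linear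
  let c : J → ℝ := fun j => -g j 0
  have hg : ∀ x (j : J), T x j - c j = g j x := by
    intro x j
    have := congrFun (AffineMap.decomp (g j)) x
    simp only [Pi.add_apply] at this
    simp [T, c, this]
  have hnorm : ∀ (x : E) (r : ℝ), 0 ≤ r → (∀ j ∈ J, |g j x| ≤ r) → ‖T x - c‖ ≤ r := by
    intro x r hr h
    rw [pi_norm_le_iff_of_nonneg hr]
    intro j
    rw [Pi.sub_apply, hg, Real.norm_eq_abs]
    exact h j j.2
  by_cases hc : c ∈ T.range
  · -- a linear right inverse of `T` onto its range supplies the correction `x - y`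
    obtain ⟨R, hR⟩ := LinearMap.exists_rightInverse_of_surjective T.rangeRestrict
      T.range_rangeRestrict
    let R' := LinearMap.toContinuousLinearMap R
    refine ⟨‖R'‖, R'.opNorm_nonneg, 1, one_pos, fun x r hr _ h => ?_⟩
    have hmem : T x - c ∈ T.range := T.range.sub_mem ⟨x, rfl⟩ hc
    refine ⟨x - R ⟨T x - c, hmem⟩, fun j hj => ?_, ?_⟩
    · have h1 : T (R ⟨T x - c, hmem⟩) = T x - c :=
        congrArg Subtype.val (LinearMap.congr_fun hR ⟨T x - c, hmem⟩)
      rw [← hg _ ⟨j, hj⟩, map_sub, h1]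
      simp
    · rw [sub_sub_cancel]
      refine (R'.le_opNorm ⟨T x - c, hmem⟩).trans ?_
      exact mul_le_mul_of_nonneg_left (hnorm x r hr h) R'.opNorm_nonneg
  · have hcl : IsClosed (T.range : Set (J → ℝ)) := T.range.closed_of_finiteDimensional
    have hpos := (hcl.notMem_iff_infDist_pos ⟨0, T.range.zero_mem⟩).1 hc
    refine ⟨0, le_rfl, _, hpos, fun x r hr hlt h => ?_⟩
    have h1 : Metric.infDist c T.range ≤ dist c (T x) := Metric.infDist_le_dist_of_mem ⟨x, rfl⟩
    rw [dist_comm, dist_eq_norm] at h1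
    linarith [hnorm x r hr h]

/-- Local Hoffman bound for the system `g j = 0` (`j ∈ J`), `g i ≤ 0` (`i ∈ I`): a point with a small
residual `r` lies within `κ * r` of a solution. Restricting to `r < δ` lets one statement cover
both consistent and inconsistent systems. The proof is by induction on the number of inequalities:
if all of them are tight or violated they may be replaced by equations; otherwise drop one that
holds strictly at `x`, and if the solution found violates it, restart from the point where the
segment to that solution crosses its boundary, with the dropped inequality turned into an
equation. -/
theorem exists_errorBound_affine_system [FiniteDimensional ℝ E] {ι : Type*} [DecidableEq ι]
    (g : ι → E →ᵃ[ℝ] ℝ) (J I : Finset ι) :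
    ∃ κ : ℝ, 0 ≤ κ ∧ ∃ δ > 0, ∀ (x : E) (r : ℝ), 0 ≤ r → r < δ → (∀ j ∈ J, |g j x| ≤ r) →
      (∀ i ∈ I, g i x ≤ r) →
      ∃ y, (∀ j ∈ J, g j y = 0) ∧ (∀ i ∈ I, g i y ≤ 0) ∧ ‖x - y‖ ≤ κ * r := by
  induction hn : I.card generalizing I J with
  | zero =>
    obtain rfl := Finset.card_eq_zero.1 hn
    obtain ⟨κ, hκ, δ, hδ, H⟩ := exists_errorBound_affine_eq g J
    refine ⟨κ, hκ, δ, hδ, fun x r hr hlt hJ _ => ?_⟩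
    obtain ⟨y, hy, hxy⟩ := H x r hr hlt hJ
    exact ⟨y, hy, by simp, hxy⟩
  | succ n ih =>
    have hcard : ∀ i : I, (I.erase i).card = n := fun i => by
      rw [Finset.card_erase_of_mem i.2, hn]; rfl
    choose κ₁ hκ₁ δ₁ hδ₁ H₁ using fun i : I => ih J (I.erase i) (hcard i)
    choose κ₂ hκ₂ δ₂ hδ₂ H₂ using fun i : I => ih (insert (i : ι) J) (I.erase i) (hcard i)
    obtain ⟨κ₃, hκ₃, δ₃, hδ₃, H₃⟩ := exists_errorBound_affine_eq g (J ∪ I)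
    have hne : (Finset.univ : Finset I).Nonempty := by
      obtain ⟨i, hi⟩ := Finset.card_pos.1 (by omega : 0 < I.card)
      exact ⟨⟨i, hi⟩, Finset.mem_univ _⟩
    refine ⟨κ₃ + ∑ i, (κ₁ i + κ₂ i), add_nonneg hκ₃
      (Finset.sum_nonneg fun i _ => add_nonneg (hκ₁ i) (hκ₂ i)),
      min δ₃ (Finset.univ.inf' hne fun i => min (δ₁ i) (δ₂ i)),
      lt_min hδ₃ ((Finset.lt_inf'_iff hne).2 fun i _ => lt_min (hδ₁ i) (hδ₂ i)),
      fun x r hr hlt hJ hI => ?_⟩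
    have hr₃ := hlt.trans_le (min_le_left _ _)
    have hr' := (Finset.lt_inf'_iff hne).1 (hlt.trans_le (min_le_right _ _))
    by_cases hall : ∀ i ∈ I, 0 ≤ g i x
    · -- every inequality is tight or violated, so each residual is that of the equation
      obtain ⟨y, hy, hxy⟩ := H₃ x r hr hr₃ fun j hj => by
        rcases Finset.mem_union.1 hj with h | h
        · exact hJ j h
        · rw [abs_of_nonneg (hall j h)]; exact hI j h
      refine ⟨y, fun j hj => hy j (Finset.mem_union_left _ hj),
        fun i hi => (hy i (Finset.mem_union_right _ hi)).le, hxy.trans ?_⟩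
      gcongr
      exact le_add_of_nonneg_right (Finset.sum_nonneg fun i _ => add_nonneg (hκ₁ i) (hκ₂ i))
    · push Not at hall
      obtain ⟨i, hi, hix⟩ := hall
      have hri := hr' ⟨i, hi⟩ (Finset.mem_univ _)
      have hle : κ₁ ⟨i, hi⟩ + κ₂ ⟨i, hi⟩ ≤ κ₃ + ∑ i, (κ₁ i + κ₂ i) :=
        (Finset.single_le_sum (f := fun i => κ₁ i + κ₂ i)
          (fun i _ => add_nonneg (hκ₁ i) (hκ₂ i)) (Finset.mem_univ _)).trans
          (le_add_of_nonneg_left hκ₃)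
      obtain ⟨p, hpJ, hpI, hxp⟩ := H₁ ⟨i, hi⟩ x r hr (hri.trans_le (min_le_left _ _)) hJ
        fun k hk => hI k (Finset.mem_of_mem_erase hk)
      by_cases hip : g i p ≤ 0
      · refine ⟨p, hpJ, fun k hk => ?_, hxp.trans ?_⟩
        · by_cases hki : k = i
          · exact hki ▸ hip
          · exact hpI k (Finset.mem_erase.2 ⟨hki, hk⟩)
        · gcongr
          linarith [hκ₂ ⟨i, hi⟩]
      · push Not at hip
        -- the point of the segment `[x, p]` on the hyperplane `g i = 0`
        set t : ℝ := -g i x / (g i p - g i x) with ht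
        have hd : 0 < g i p - g i x := by linarith
        have ht0 : 0 ≤ t := div_nonneg (by linarith) hd.le
        have ht1 : t ≤ 1 := (div_le_one hd).2 (by linarith)
        have hs : ∀ k, g k (AffineMap.lineMap x p t) = (1 - t) * g k x + t * g k p := by
          intro k
          rw [AffineMap.apply_lineMap, AffineMap.lineMap_apply_ring]
        have hsi : g i (AffineMap.lineMap x p t) = 0 := by
          rw [hs, ht]; field_simp; ring
        obtain ⟨y, hyJ, hyI, hsy⟩ := H₂ ⟨i, hi⟩ (AffineMap.lineMap x p t) r hr
          (hri.trans_le (min_le_right _ _))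
          (fun k hk => by
            rcases Finset.mem_insert.1 hk with h | h
            · rw [h, hsi, abs_zero]; exact hr
            · rw [hs, hpJ k h, mul_zero, add_zero, abs_mul, abs_of_nonneg (by linarith)]
              calc (1 - t) * |g k x| ≤ 1 * |g k x| := by gcongr; linarith
                _ ≤ r := by rw [one_mul]; exact hJ k h)
          (fun k hk => by
            have h1 := hpI k hk
            have h2 := hI k (Finset.mem_of_mem_erase hk)
            rw [hs]
            have h3 : (1 - t) * g k x ≤ (1 - t) * r :=
              mul_le_mul_of_nonneg_left h2 (by linarith)
            have h4 : t * g k p ≤ 0 := mul_nonpos_of_nonneg_of_nonpos ht0 h1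
            nlinarith)
        refine ⟨y, fun j hj => hyJ j (Finset.mem_insert_of_mem hj), fun k hk => ?_, ?_⟩
        · by_cases hki : k = i
          · exact hki ▸ (hyJ i (Finset.mem_insert_self _ _)).le
          · exact hyI k (Finset.mem_erase.2 ⟨hki, hk⟩)
        · have hxs : ‖x - AffineMap.lineMap x p t‖ ≤ ‖x - p‖ := by
            rw [← dist_eq_norm, dist_left_lineMap, dist_eq_norm, Real.norm_of_nonneg ht0]
            exact mul_le_of_le_one_left (norm_nonneg _) ht1
          calc ‖x - y‖ ≤ ‖x - AffineMap.lineMap x p t‖ + ‖AffineMap.lineMap x p t - y‖ :=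
                norm_sub_le_norm_sub_add_norm_sub _ _ _
            _ ≤ κ₁ ⟨i, hi⟩ * r + κ₂ ⟨i, hi⟩ * r := add_le_add (hxs.trans hxp) hsy
            _ = (κ₁ ⟨i, hi⟩ + κ₂ ⟨i, hi⟩) * r := by ring
            _ ≤ _ := by gcongr

/-- A map is piecewise affine if it is a continuous selection of finitely many affine maps. -/
def IsPiecewiseAffine (f : E → F) : Prop :=
  Continuous f ∧ ∃ S : Set (E →ᵃ[ℝ] F), S.Finite ∧ ∀ x, ∃ g ∈ S, f x = g x

/-- If `y` lies in the closed cell of `x` of the hyperplane arrangement formed by the coordinates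
of the differences `g₁ - g₂`, then `f` is given by the same affine map at `x` and at `y`. Indeed
two maps of `S` that differ at `x` differ all along `[x, y)`, so by connectedness `f` cannot switch
between them there. -/
theorem eq_of_mem_closed_cell [FiniteDimensional ℝ E] {f : E → F} (hf : Continuous f)
    {S : Set (E →ᵃ[ℝ] F)} (hS : S.Finite) (hfS : ∀ x, ∃ g ∈ S, f x = g x)
    {ι : Type*} [Fintype ι] (b : OrthonormalBasis ι ℝ F) {x y : E}
    (hxy : ∀ g₁ ∈ S, ∀ g₂ ∈ S, ∀ c, ⟪b c, g₁ x - g₂ x⟫_ℝ ≤ 0 → ⟪b c, g₁ y - g₂ y⟫_ℝ ≤ 0)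
    {g : E →ᵃ[ℝ] F} (hg : g ∈ S) (hx : f x = g x) : f y = g y := by
  have hcg : ∀ g : E →ᵃ[ℝ] F, Continuous g := fun g => g.continuous_of_finiteDimensional
  have hline : Continuous (fun t : ℝ => (AffineMap.lineMap x y t : E)) :=
    AffineMap.lineMap_continuous
  -- two of the affine maps that differ at `x` differ all along `[x, y)`
  have hsep : ∀ g' ∈ S, ∀ t ∈ Set.Ico (0 : ℝ) 1,
      g (AffineMap.lineMap x y t) = g' (AffineMap.lineMap x y t) → g x = g' x := by
    intro g' hg' t ht h
    by_contra hne
    obtain ⟨c, hc⟩ : ∃ c, ⟪b c, g x - g' x⟫_ℝ ≠ 0 := by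
      by_contra! hall
      exact hne (sub_eq_zero.1 (InnerProductSpace.ext_inner_left_basis (𝕜 := ℝ) b.toBasis
        fun c => by simpa using hall c))
    have hφ : (1 - t) * ⟪b c, g x - g' x⟫_ℝ + t * ⟪b c, g y - g' y⟫_ℝ = 0 := by
      have h0 : g (AffineMap.lineMap x y t) - g' (AffineMap.lineMap x y t) = 0 := sub_eq_zero.2 h
      rw [AffineMap.apply_lineMap, AffineMap.apply_lineMap, AffineMap.lineMap_apply_module,
        AffineMap.lineMap_apply_module] at h0
      rw [← inner_smul_right, ← inner_smul_right, ← inner_add_right,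
        ← inner_zero_right (𝕜 := ℝ) (b c), ← h0]
      congr 1
      module
    have hneg : ∀ z : E, ⟪b c, g' z - g z⟫_ℝ = -⟪b c, g z - g' z⟫_ℝ := fun z => by
      rw [← neg_sub, inner_neg_right]
    have h1 := hxy g hg g' hg' c
    have h2 := hxy g' hg' g hg c
    rw [hneg, hneg] at h2
    have ht1 : 0 < 1 - t := by linarith [ht.2]
    rcases lt_or_gt_of_ne hc with h3 | h3
    · have := mul_neg_of_pos_of_neg ht1 h3
      have := mul_nonpos_of_nonneg_of_nonpos ht.1 (h1 h3.le)
      linarith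
    · have := mul_pos ht1 h3
      have := mul_nonneg ht.1 (neg_nonpos.1 (h2 (by linarith)))
      linarith
  let A : Set ℝ := {t | f (AffineMap.lineMap x y t) = g (AffineMap.lineMap x y t)}
  let B : Set ℝ := ⋃ g' ∈ {g' ∈ S | g x ≠ g' x},
    {t | f (AffineMap.lineMap x y t) = g' (AffineMap.lineMap x y t)}
  have hA : IsClosed A := isClosed_eq (hf.comp hline) ((hcg g).comp hline)
  have hB : IsClosed B := (hS.subset (Set.sep_subset _ _)).isClosed_biUnion fun g' _ =>
    isClosed_eq (hf.comp hline) ((hcg g').comp hline)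
  have hsub : Set.Ico (0 : ℝ) 1 ⊆ A := by
    intro t ht
    have hcov : Set.Ico (0 : ℝ) 1 ⊆ A ∪ B := by
      intro s hs
      obtain ⟨g', hg', h⟩ := hfS (AffineMap.lineMap x y s)
      by_cases hgg : g x = g' x
      · left
        by_contra hsA
        exact hsA (h.trans (by
          have hagree : ∀ c, ⟪b c, g y - g' y⟫_ℝ = 0 := fun c => by
            have h1 := hxy g hg g' hg' c (by rw [hgg, sub_self, inner_zero_right])
            have h2 := hxy g' hg' g hg c (by rw [hgg, sub_self, inner_zero_right])
            rw [← neg_sub, inner_neg_right] at h2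
            linarith
          have hy : g y = g' y :=
            sub_eq_zero.1 (InnerProductSpace.ext_inner_left_basis (𝕜 := ℝ) b.toBasis
              fun c => by simpa using hagree c)
          rw [AffineMap.apply_lineMap, AffineMap.apply_lineMap, hgg, hy]))
      · right
        exact Set.mem_biUnion (x := g') ⟨hg', hgg⟩ h
    by_contra htA
    have htB : t ∈ B := (hcov ht).resolve_left htA
    obtain ⟨s, hs, hsA, hsB⟩ := isPreconnected_closed_iff.1 isPreconnected_Ico A B hA hB hcov
      ⟨0, ⟨le_rfl, one_pos⟩, by simpa [A] using hx⟩ ⟨t, ht, htB⟩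
    obtain ⟨g', ⟨hg', hne⟩, h⟩ := Set.mem_iUnion₂.1 hsB
    exact hne (hsep g' hg' s hs (hsA.symm.trans h))
  have h1 : (1 : ℝ) ∈ A := by
    have := hA.closure_subset_iff.2 hsub
    rw [closure_Ico zero_ne_one] at this
    exact this ⟨zero_le_one, le_rfl⟩
  simpa [A] using h1

/-- Robinson's error bound. The zero set of `f` contains the solution set of the system
made of the equation `g = 0`, with `g` an affine map giving `f` at `w`, and of the inequalities of
the closed cell of `w`. Only finitely many such systems occur. -/
theorem IsPiecewiseAffine.localErrorBound [FiniteDimensional ℝ E] {f : E → E}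
    (hf : IsPiecewiseAffine f) : LocalErrorBound f := by
  classical
  obtain ⟨hcont, S₀, hS₀, hfS₀⟩ := hf
  -- the zero map is added so that the equation `g = 0` is one of the comparisons `g₁ = g₂`
  set S : Set (E →ᵃ[ℝ] E) := insert 0 S₀ with hSdef
  have hS : S.Finite := hS₀.insert 0
  have hfS : ∀ x, ∃ g ∈ S, f x = g x := fun x => by
    obtain ⟨g, hg, h⟩ := hfS₀ x
    exact ⟨g, Set.mem_insert_of_mem _ hg, h⟩
  have : Fintype S := hS.fintype
  let b := stdOrthonormalBasis ℝ E
  let ι := S × S × Fin (Module.finrank ℝ E)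
  let φ : ι → E →ᵃ[ℝ] ℝ := fun i =>
    (innerSL ℝ (b i.2.2)).toLinearMap.toAffineMap.comp ((i.1 : E →ᵃ[ℝ] E) - (i.2.1 : E →ᵃ[ℝ] E))
  have hφ : ∀ i x, φ i x = ⟪b i.2.2, (i.1 : E →ᵃ[ℝ] E) x - (i.2.1 : E →ᵃ[ℝ] E) x⟫_ℝ :=
    fun i x => rfl
  choose κ hκ δ hδ H using fun q : Finset ι × Finset ι =>
    exists_errorBound_affine_system φ q.1 q.2
  have hne : (Finset.univ : Finset (Finset ι × Finset ι)).Nonempty := Finset.univ_nonempty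
  set K : ℝ := 1 + ∑ q, κ q with hK
  set d : ℝ := Finset.univ.inf' hne δ with hd
  have hK0 : 0 < K := by
    have := Finset.sum_nonneg fun q (_ : q ∈ Finset.univ) => hκ q
    linarith
  have hd0 : 0 < d := (Finset.lt_inf'_iff hne).2 fun q _ => hδ q
  refine ⟨1, one_pos, min K⁻¹ d, lt_min (inv_pos.2 hK0) hd0, fun w hw => ?_⟩
  have hdist := Metric.infDist_nonneg (x := w) (s := {u | f u = 0})
  by_cases hlt : ‖f w‖ < d
  · obtain ⟨g, hg, hgw⟩ := hfS w
    let z : S := ⟨0, Set.mem_insert _ _⟩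
    let J : Finset ι := Finset.univ.image fun c => (⟨g, hg⟩, z, c)
    let I : Finset ι := Finset.univ.filter fun i => φ i w ≤ 0
    have hJ0 : ∀ c x, φ (⟨g, hg⟩, z, c) x = ⟪b c, g x⟫_ℝ := fun c x => by simp [hφ, z]
    obtain ⟨y, hyJ, hyI, hwy⟩ := H (J, I) w ‖f w‖ (norm_nonneg _)
      (hlt.trans_le (Finset.inf'_le _ (Finset.mem_univ _)))
      (fun j hj => by
        obtain ⟨c, -, rfl⟩ := Finset.mem_image.1 hj
        rw [hJ0, ← hgw]
        exact (abs_real_inner_le_norm _ _).trans (by simp))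
      (fun i hi => ((Finset.mem_filter.1 hi).2).trans (norm_nonneg _))
    have hfy : f y = g y := eq_of_mem_closed_cell hcont hS hfS b
      (fun g₁ h₁ g₂ h₂ c hle => hyI (⟨g₁, h₁⟩, ⟨g₂, h₂⟩, c)
        (Finset.mem_filter.2 ⟨Finset.mem_univ _, hle⟩)) hg hgw
    have hgy : g y = 0 := InnerProductSpace.ext_inner_left_basis (𝕜 := ℝ) b.toBasis fun c => by
      have := hyJ _ (Finset.mem_image_of_mem _ (Finset.mem_univ c))
      rw [hJ0] at this
      simpa using this
    have h1 : Metric.infDist w {u | f u = 0} ≤ ‖w - y‖ := by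
      rw [← dist_eq_norm]
      exact Metric.infDist_le_dist_of_mem (hfy.trans hgy)
    have h2 : κ (J, I) ≤ K := by
      have := Finset.single_le_sum (fun q _ => hκ q) (Finset.mem_univ (J, I))
      linarith
    have h3 : Metric.infDist w {u | f u = 0} ≤ K * ‖f w‖ :=
      h1.trans (hwy.trans (mul_le_mul_of_nonneg_right h2 (norm_nonneg _)))
    calc min K⁻¹ d * Metric.infDist w {u | f u = 0} ≤ K⁻¹ * (K * ‖f w‖) :=
          mul_le_mul (min_le_left _ _) h3 hdist (inv_pos.2 hK0).le
      _ = ‖f w‖ := inv_mul_cancel_left₀ hK0.ne' _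
  · -- a residual bounded below suffices since `infDist w _ ≤ 1`
    push Not at hlt
    calc min K⁻¹ d * Metric.infDist w {u | f u = 0} ≤ d * 1 :=
          mul_le_mul (min_le_right _ _) hw hdist hd0.le
      _ ≤ ‖f w‖ := by rwa [mul_one]

end ErrorBound

/-! ### Functions with a piecewise affine gradient -/

section PiecewiseAffineCalculus

variable {E F G : Type*} [NormedAddCommGroup E] [InnerProductSpace ℝ E]
  [NormedAddCommGroup F] [InnerProductSpace ℝ F] [NormedAddCommGroup G] [InnerProductSpace ℝ G]

theorem isPiecewiseAffine_affineMap [FiniteDimensional ℝ E] (g : E →ᵃ[ℝ] F) :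
    IsPiecewiseAffine g :=
  ⟨g.continuous_of_finiteDimensional, {g}, Set.finite_singleton g, fun _ => ⟨g, rfl, rfl⟩⟩

theorem IsPiecewiseAffine.comp_affineMap [FiniteDimensional ℝ E] {f : F → G}
    (hf : IsPiecewiseAffine f) (g : E →ᵃ[ℝ] F) : IsPiecewiseAffine fun x => f (g x) := by
  obtain ⟨hc, S, hS, h⟩ := hf
  refine ⟨hc.comp g.continuous_of_finiteDimensional, (fun s => s.comp g) '' S, hS.image _,
    fun x => ?_⟩
  obtain ⟨s, hs, hx⟩ := h (g x)
  exact ⟨_, Set.mem_image_of_mem _ hs, hx⟩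

theorem IsPiecewiseAffine.affineMap_comp [FiniteDimensional ℝ F] {f : E → F}
    (g : F →ᵃ[ℝ] G) (hf : IsPiecewiseAffine f) : IsPiecewiseAffine fun x => g (f x) := by
  obtain ⟨hc, S, hS, h⟩ := hf
  refine ⟨g.continuous_of_finiteDimensional.comp hc, (fun s => g.comp s) '' S, hS.image _,
    fun x => ?_⟩
  obtain ⟨s, hs, hx⟩ := h x
  exact ⟨_, Set.mem_image_of_mem _ hs, congrArg g hx⟩

theorem IsPiecewiseAffine.add {f g : E → F} (hf : IsPiecewiseAffine f)
    (hg : IsPiecewiseAffine g) : IsPiecewiseAffine fun x => f x + g x := by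
  obtain ⟨hfc, S, hS, hfS⟩ := hf
  obtain ⟨hgc, T, hT, hgT⟩ := hg
  refine ⟨hfc.add hgc, Set.image2 (fun s t => s + t) S T, hS.image2 _ hT, fun x => ?_⟩
  obtain ⟨s, hs, hsx⟩ := hfS x
  obtain ⟨t, ht, htx⟩ := hgT x
  exact ⟨_, Set.mem_image2_of_mem hs ht, by
    simp only [hsx, htx, AffineMap.coe_add, Pi.add_apply]⟩

/-- The function is differentiable everywhere and its gradient is a piecewise affine map. The
gradient is encoded through the Fréchet derivative `⟪g x, ·⟫`, which needs no completeness. -/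
def HasPiecewiseAffineGradient (f : E → ℝ) : Prop :=
  ∃ g : E → E, (∀ x, HasFDerivAt f (innerSL ℝ (g x)) x) ∧ IsPiecewiseAffine g

theorem hasPiecewiseAffineGradient_zero [FiniteDimensional ℝ E] :
    HasPiecewiseAffineGradient (fun _ : E => (0 : ℝ)) :=
  ⟨fun _ => 0, fun x => by simpa using hasFDerivAt_const (0 : ℝ) x,
    isPiecewiseAffine_affineMap (0 : E →ᵃ[ℝ] E)⟩

theorem HasPiecewiseAffineGradient.add {f g : E → ℝ} (hf : HasPiecewiseAffineGradient f)
    (hg : HasPiecewiseAffineGradient g) : HasPiecewiseAffineGradient fun x => f x + g x := by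
  obtain ⟨f', hf', hfa⟩ := hf
  obtain ⟨g', hg', hga⟩ := hg
  exact ⟨_, fun x => by simpa using! (hf' x).add (hg' x), hfa.add hga⟩

theorem HasPiecewiseAffineGradient.sum [FiniteDimensional ℝ E] {ι : Type*} (s : Finset ι)
    {f : ι → E → ℝ} (hf : ∀ i ∈ s, HasPiecewiseAffineGradient (f i)) :
    HasPiecewiseAffineGradient fun x => ∑ i ∈ s, f i x := by
  classical
  induction s using Finset.induction_on with
  | empty => simpa using hasPiecewiseAffineGradient_zero
  | insert a s ha ih =>
    simp only [Finset.sum_insert ha]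
    exact (hf a (Finset.mem_insert_self _ _)).add
      (ih fun i hi => hf i (Finset.mem_insert_of_mem hi))

theorem HasPiecewiseAffineGradient.comp_affine [FiniteDimensional ℝ E] [FiniteDimensional ℝ F]
    {f : F → ℝ} (hf : HasPiecewiseAffineGradient f) (T : E →ₗ[ℝ] F) (c : F) :
    HasPiecewiseAffineGradient fun x => f (T x + c) := by
  obtain ⟨f', hf', hfa⟩ := hf
  refine ⟨fun x => T.adjoint (f' (T x + c)), fun x => ?_, ?_⟩
  · have hT : HasFDerivAt (fun x => T x + c) T.toContinuousLinearMap x :=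
      T.toContinuousLinearMap.hasFDerivAt.add_const c
    convert! (hf' (T x + c)).comp x hT using 1
    ext v
    simp [LinearMap.adjoint_inner_left]
  · exact (hfa.comp_affineMap (T.toAffineMap + AffineMap.const ℝ E c)).affineMap_comp
      T.adjoint.toAffineMap

theorem hasPiecewiseAffineGradient_const_mul_norm_sq [FiniteDimensional ℝ E] (c : ℝ) :
    HasPiecewiseAffineGradient fun x : E => c * ‖x‖ ^ 2 := by
  refine ⟨fun x => (2 * c) • x, fun x => ?_,
    isPiecewiseAffine_affineMap (LinearMap.lsmul ℝ E (2 * c)).toAffineMap⟩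
  convert! ((hasStrictFDerivAt_norm_sq x).hasFDerivAt).const_mul c using 1
  ext v
  simp
  ring

theorem IsPolyhedral.isClosed {C : Set E} (hC : IsPolyhedral C) : IsClosed C := by
  obtain ⟨m, a, β, rfl⟩ := hC
  simp only [Set.ofPred_forall]
  exact isClosed_iInter fun i => isClosed_le (by fun_prop) continuous_const

theorem hasFDerivAt_quadratic [FiniteDimensional ℝ E] {Q : E →ₗ[ℝ] E} (hQ : Q.IsSymmetric)
    (a : E) (α : ℝ) (x : E) :
    HasFDerivAt (fun x => 1 / 2 * ⟪x, Q x⟫_ℝ + ⟪a, x⟫_ℝ + α) (innerSL ℝ (Q x + a)) x := by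
  have hQd : HasFDerivAt (fun x => Q x) Q.toContinuousLinearMap x :=
    Q.toContinuousLinearMap.hasFDerivAt
  have h1 := (((hasFDerivAt_id x).inner ℝ hQd).const_mul (1 / 2)).add
    (innerSL ℝ a).hasFDerivAt |>.add_const α
  convert! h1 using 1
  ext v
  have : ⟪Q x, v⟫_ℝ = ⟪x, Q v⟫_ℝ := hQ x v
  simp [fderivInnerCLM_apply, real_inner_comm (Q x) v, this]
  ring

/-- On the interior of a piece the gradient of `f` is that of the quadratic, and by Baire's
theorem the interiors of the pieces are dense; a continuous gradient is then given by one of the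
affine maps `x ↦ Q k x + a k` at every point. -/
theorem hasPiecewiseAffineGradient_of_plq [FiniteDimensional ℝ E] {f : E → ℝ}
    (hf : ContDiff ℝ 1 f) (hplq : IsPiecewiseLinearQuadratic fun x => ((f x : ℝ) : EReal)) :
    HasPiecewiseAffineGradient f := by
  obtain ⟨K, C, Q, a, α, hC, hQ, hdom, hq⟩ := hplq
  have : CompleteSpace E := FiniteDimensional.complete ℝ E
  let g : E → E := fun x => (InnerProductSpace.toDual ℝ E).symm (fderiv ℝ f x)
  have hg : ∀ x, HasFDerivAt f (innerSL ℝ (g x)) x := fun x => by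
    have h1 : innerSL ℝ (g x) = fderiv ℝ f x :=
      (InnerProductSpace.toDual ℝ E).apply_symm_apply (fderiv ℝ f x)
    rw [h1]
    exact (hf.differentiable one_ne_zero x).hasFDerivAt
  have hgc : Continuous g :=
    (InnerProductSpace.toDual ℝ E).symm.continuous.comp (hf.continuous_fderiv one_ne_zero)
  let s : Fin K → E →ᵃ[ℝ] E := fun k => (Q k).toAffineMap + AffineMap.const ℝ E (a k)
  refine ⟨g, hg, hgc, Set.range s, Set.finite_range s, fun x => ?_⟩
  have hdense : Dense (⋃ k, interior (C k)) :=
    dense_iUnion_interior_of_closed (fun k => (hC k).isClosed) (by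
      rw [← hdom]; exact Set.eq_univ_of_forall fun x => EReal.coe_lt_top _)
  have hx := hdense x
  rw [closure_iUnion_of_finite] at hx
  obtain ⟨k, hk⟩ := Set.mem_iUnion.1 hx
  refine ⟨s k, ⟨k, rfl⟩, ?_⟩
  have hint : ∀ y ∈ interior (C k), g y = s k y := by
    intro y hy
    have h1 : f =ᶠ[nhds y] fun x => 1 / 2 * ⟪x, Q k x⟫_ℝ + ⟪a k, x⟫_ℝ + α k := by
      filter_upwards [mem_interior_iff_mem_nhds.1 hy] with z hz
      exact EReal.coe_injective (hq k z hz)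
    have h2 := ((hasFDerivAt_quadratic (hQ k) (a k) (α k) y).congr_of_eventuallyEq h1).unique (hg y)
    exact ((InnerProductSpace.toDual ℝ E).injective h2).symm
  have hcl : IsClosed {y | g y = s k y} :=
    isClosed_eq hgc (s k).continuous_of_finiteDimensional
  exact hcl.closure_subset_iff.2 hint hk

end PiecewiseAffineCalculus

/-! ### Proximal points and Moreau envelopes -/

section MoreauEnvelope

theorem IsProper.exists_real {α : Type*} {h : α → EReal} (hp : IsProper h) :
    ∃ x, ∃ c : ℝ, h x = c := by
  obtain ⟨x, hx⟩ := hp.2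
  exact ⟨x, (h x).toReal, (EReal.coe_toReal hx (hp.1 x)).symm⟩

variable {E : Type*} [NormedAddCommGroup E] [InnerProductSpace ℝ E]

theorem nonneg_of_forall_add_sq_nonneg {c m : ℝ}
    (h : ∀ t : ℝ, 0 < t → t ≤ 1 → 0 ≤ t * c + t ^ 2 * m) : 0 ≤ c := by
  by_contra! hc
  have hM : 0 < |m| + |c| := add_pos_of_nonneg_of_pos (abs_nonneg m) (abs_pos.2 hc.ne)
  have ht0 : 0 < -c / (2 * (|m| + |c|)) := div_pos (by linarith) (by linarith)
  have ht1 : -c / (2 * (|m| + |c|)) ≤ 1 := by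
    rw [div_le_one (by linarith)]
    linarith [neg_le_abs c, abs_nonneg m, abs_nonneg c]
  set t := -c / (2 * (|m| + |c|)) with ht
  have h1 := h t ht0 ht1
  have h2 : t * (|m| + |c|) = -c / 2 := by rw [ht]; field_simp
  have h3 : t * m ≤ -c / 2 := by
    rw [← h2]
    exact mul_le_mul_of_nonneg_left ((le_abs_self m).trans (by linarith [abs_nonneg c])) ht0.le
  have h4 : t * (c + t * m) < 0 := mul_neg_of_pos_of_neg ht0 (by linarith)
  nlinarith

theorem IsConvexFun.le_of_le {h : E → EReal} (hc : IsConvexFun h) {x y : E} {c d t : ℝ}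
    (hx : h x ≤ c) (hy : h y ≤ d) (ht0 : 0 ≤ t) (ht1 : t ≤ 1) :
    h ((1 - t) • x + t • y) ≤ (((1 - t) * c + t * d : ℝ) : EReal) :=
  hc (x := (x, c)) hx (y := (y, d)) hy (by linarith : 0 ≤ 1 - t) ht0 (by ring)

/-- On a unit ball around a point of the domain `h` is bounded below by lower semicontinuity, and
convexity propagates this bound along rays. -/
theorem IsProperClosedConvex.exists_linear_lower_bound [FiniteDimensional ℝ E] {h : E → EReal}
    (hh : IsProperClosedConvex h) {x₀ : E} {c₀ : ℝ} (hx₀ : h x₀ = c₀) :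
    ∃ B : ℝ, 0 ≤ B ∧ ∀ y, ((c₀ - B * (1 + ‖y - x₀‖) : ℝ) : EReal) ≤ h y := by
  obtain ⟨hp, hl, hc⟩ := hh
  have : ProperSpace E := FiniteDimensional.proper ℝ E
  obtain ⟨q, hq, hmin⟩ := (hl.lowerSemicontinuousOn (Metric.closedBall x₀ 1)).exists_isMinOn
    ⟨x₀, Metric.mem_closedBall_self zero_le_one⟩ (isCompact_closedBall x₀ 1)
  have hq0 : h q ≤ c₀ := hx₀ ▸ hmin (Metric.mem_closedBall_self zero_le_one)
  obtain ⟨M, hM⟩ : ∃ M : ℝ, h q = M :=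
    ⟨(h q).toReal, (EReal.coe_toReal (ne_top_of_le_ne_top (EReal.coe_ne_top _) hq0) (hp.1 q)).symm⟩
  have hMc : M ≤ c₀ := EReal.coe_le_coe_iff.1 (hM ▸ hq0)
  refine ⟨c₀ - M, by linarith, fun y => ?_⟩
  by_cases hy : h y = ⊤
  · rw [hy]; exact le_top
  obtain ⟨d, hd⟩ : ∃ d : ℝ, h y = d := ⟨(h y).toReal, (EReal.coe_toReal hy (hp.1 y)).symm⟩
  rw [hd, EReal.coe_le_coe_iff]
  -- the point of `[x₀, y]` at parameter `1 / (1 + ‖y - x₀‖)` lies in the unit ball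
  set R : ℝ := 1 + ‖y - x₀‖ with hR
  have hR1 : 1 ≤ R := by linarith [norm_nonneg (y - x₀)]
  have ht0 : 0 ≤ R⁻¹ := by positivity
  have ht1 : R⁻¹ ≤ 1 := inv_le_one_of_one_le₀ hR1
  have hmem : (1 - R⁻¹) • x₀ + R⁻¹ • y ∈ Metric.closedBall x₀ 1 := by
    rw [mem_closedBall_iff_norm, show (1 - R⁻¹) • x₀ + R⁻¹ • y - x₀ = R⁻¹ • (y - x₀) by module,
      norm_smul, Real.norm_of_nonneg ht0, inv_mul_le_one₀ (by linarith)]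
    linarith
  have h1 := (hmin hmem).trans (hc.le_of_le hx₀.le hd.le ht0 ht1)
  rw [hM, EReal.coe_le_coe_iff] at h1
  have h2 : R * M ≤ R * ((1 - R⁻¹) * c₀ + R⁻¹ * d) := mul_le_mul_of_nonneg_left h1 (by linarith)
  have h3 : R * ((1 - R⁻¹) * c₀ + R⁻¹ * d) = R * c₀ - c₀ + d := by
    field_simp
  linarith

/-- Existence of the proximal point `p` of `u`, described by its variational inequality
`σ (u - p) ∈ ∂h(p)`. -/
theorem IsProperClosedConvex.exists_prox [FiniteDimensional ℝ E] {h : E → EReal}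
    (hh : IsProperClosedConvex h) {σ : ℝ} (hσ : 0 < σ) (u : E) :
    ∃ p : E, ∃ c : ℝ, h p = c ∧ ∀ y, ((c + σ * ⟪u - p, y - p⟫_ℝ : ℝ) : EReal) ≤ h y := by
  have : ProperSpace E := FiniteDimensional.proper ℝ E
  obtain ⟨x₀, c₀, hx₀⟩ := hh.1.exists_real
  obtain ⟨B, hB, hlow⟩ := hh.exists_linear_lower_bound hx₀
  obtain ⟨hp, hl, hc⟩ := hh
  let g : E → EReal := fun y => h y + ((σ / 2 * ‖y - u‖ ^ 2 : ℝ) : EReal)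
  have hg : LowerSemicontinuous g := hl.add'
    (continuous_coe_real_ereal.comp (by fun_prop :
      Continuous fun y : E => σ / 2 * ‖y - u‖ ^ 2)).lowerSemicontinuous
    fun x => EReal.continuousAt_add (.inr (EReal.coe_ne_bot _)) (.inr (EReal.coe_ne_top _))
  -- outside the ball of radius `ρ` the quadratic term beats the linear lower bound of `h`
  set D : ℝ := ‖x₀ - u‖ with hD
  have hD0 : 0 ≤ D := norm_nonneg _
  set ρ : ℝ := D + 4 * B / σ + 1 with hρ
  have hρD : D ≤ ρ := by
    have : 0 ≤ 4 * B / σ := by positivity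
    linarith
  have hx₀mem : x₀ ∈ Metric.closedBall u ρ := mem_closedBall_iff_norm.2 hρD
  obtain ⟨p, hpmem, hmin⟩ := (hg.lowerSemicontinuousOn (Metric.closedBall u ρ)).exists_isMinOn
    ⟨x₀, hx₀mem⟩ (isCompact_closedBall u ρ)
  have hgx₀ : g x₀ = ((c₀ + σ / 2 * D ^ 2 : ℝ) : EReal) := by simp only [g, hx₀, EReal.coe_add, hD]
  have hpx₀ : g p ≤ ((c₀ + σ / 2 * D ^ 2 : ℝ) : EReal) := hgx₀ ▸ hmin hx₀mem
  have hptop : h p ≠ ⊤ := by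
    intro htop
    simp only [g, htop, EReal.top_add_coe] at hpx₀
    exact EReal.coe_ne_top _ (top_le_iff.1 hpx₀)
  obtain ⟨c, hcp⟩ : ∃ c : ℝ, h p = c := ⟨(h p).toReal, (EReal.coe_toReal hptop (hp.1 p)).symm⟩
  have hgp : g p = ((c + σ / 2 * ‖p - u‖ ^ 2 : ℝ) : EReal) := by
    simp only [g, hcp, EReal.coe_add]
  have hglob : ∀ y, g p ≤ g y := by
    intro y
    by_cases hy : y ∈ Metric.closedBall u ρ
    · exact hmin hy
    · rw [mem_closedBall_iff_norm, not_le] at hy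
      refine hpx₀.trans (le_trans ?_ (add_le_add_left (hlow y) _))
      rw [← EReal.coe_add, EReal.coe_le_coe_iff]
      set s := ‖y - u‖ with hs
      have h1 : ‖y - x₀‖ ≤ s + D := by
        rw [hs, hD]
        calc ‖y - x₀‖ = ‖(y - u) - (x₀ - u)‖ := by congr 1; abel
          _ ≤ _ := norm_sub_le _ _
      have h4 : 4 * B / σ ≤ s - D := by linarith
      have h5 : 4 * B ≤ (s - D) * σ := (div_le_iff₀ hσ).1 h4
      have h6 : 0 ≤ (s + D) * ((s - D) * σ - 4 * B) := mul_nonneg (by linarith) (by linarith)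
      have h7 : 1 ≤ s + D := by
        have : 0 ≤ 4 * B / σ := by positivity
        linarith
      have h8 : B * (1 + ‖y - x₀‖) ≤ B * (2 * (s + D)) :=
        mul_le_mul_of_nonneg_left (by linarith) hB
      nlinarith
  refine ⟨p, c, hcp, fun y => ?_⟩
  by_cases hy : h y = ⊤
  · rw [hy]; exact le_top
  obtain ⟨d, hd⟩ : ∃ d : ℝ, h y = d := ⟨(h y).toReal, (EReal.coe_toReal hy (hp.1 y)).symm⟩
  rw [hd, EReal.coe_le_coe_iff]
  suffices 0 ≤ d - c - σ * ⟪u - p, y - p⟫_ℝ by linarith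
  refine nonneg_of_forall_add_sq_nonneg (m := σ / 2 * ‖y - p‖ ^ 2) fun t ht0 ht1 => ?_
  have h1 := (hglob ((1 - t) • p + t • y)).trans
    (add_le_add_left (hc.le_of_le hcp.le hd.le ht0.le ht1) _)
  rw [hgp, ← EReal.coe_add, EReal.coe_le_coe_iff,
    show (1 - t) • p + t • y - u = t • (y - p) - (u - p) by module,
    norm_sub_sq_real (t • (y - p)) (u - p), norm_smul, inner_smul_left,
    Real.norm_of_nonneg ht0.le, real_inner_comm, norm_sub_rev p u] at h1
  simp only [conj_trivial] at h1
  nlinarith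

/-- The proximal map is nonexpansive: add the variational inequalities at `u` and `v`. -/
theorem norm_prox_sub_prox_le {h : E → EReal} {σ : ℝ} (hσ : 0 < σ) {prox : E → E} {val : E → ℝ}
    (hval : ∀ u, h (prox u) = val u)
    (hvi : ∀ u y, ((val u + σ * ⟪u - prox u, y - prox u⟫_ℝ : ℝ) : EReal) ≤ h y) (u v : E) :
    ‖prox u - prox v‖ ≤ ‖u - v‖ := by
  have h1 := hvi u (prox v)
  have h2 := hvi v (prox u)
  rw [hval, EReal.coe_le_coe_iff] at h1 h2
  have h3 : σ * (⟪u - prox u, prox v - prox u⟫_ℝ + ⟪v - prox v, prox u - prox v⟫_ℝ) ≤ 0 := by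
    linarith
  have h4 := nonpos_of_mul_nonpos_right h3 hσ
  have h5 : ⟪u - prox u, prox v - prox u⟫_ℝ + ⟪v - prox v, prox u - prox v⟫_ℝ =
      ‖prox u - prox v‖ ^ 2 - ⟪u - v, prox u - prox v⟫_ℝ := by
    rw [← real_inner_self_eq_norm_sq, ← neg_sub (prox u) (prox v), inner_neg_right,
      ← sub_eq_neg_add, ← inner_sub_left, ← inner_sub_left]
    congr 1
    abel
  have h6 := real_inner_le_norm (u - v) (prox u - prox v)
  by_contra! hlt
  nlinarith [norm_nonneg (u - v), norm_nonneg (prox u - prox v)]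

theorem hasFDerivAt_of_quadratic_bound {f : E → ℝ} {g u : E} {M : ℝ}
    (hf : ∀ v, |f v - f u - ⟪g, v - u⟫_ℝ| ≤ M * ‖v - u‖ ^ 2) :
    HasFDerivAt f (innerSL ℝ g) u := by
  refine HasFDerivAt.of_isLittleO ?_
  refine (Asymptotics.IsBigO.of_bound M (Filter.Eventually.of_forall fun v => ?_) :
    _ =O[nhds u] fun v => ‖v - u‖ ^ 2).trans_isLittleO ?_
  · simpa using hf v
  · exact Asymptotics.isLittleO_pow_sub_sub u one_lt_two

/-- The Moreau envelope has gradient `σ (u - prox u)`: the variational inequality at `u` bounds its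
increments from below by their linearization, and the one at `v` bounds them from above. -/
theorem hasFDerivAt_moreauEnvelope {h : E → EReal} {σ : ℝ} (hσ : 0 < σ) {prox : E → E}
    {val : E → ℝ} (hval : ∀ u, h (prox u) = val u)
    (hvi : ∀ u y, ((val u + σ * ⟪u - prox u, y - prox u⟫_ℝ : ℝ) : EReal) ≤ h y) (u : E) :
    HasFDerivAt (fun u => val u + σ / 2 * ‖prox u - u‖ ^ 2) (innerSL ℝ (σ • (u - prox u))) u := by
  refine hasFDerivAt_of_quadratic_bound (M := σ / 2) fun v => ?_
  have key : ∀ u v, val u + σ / 2 * ‖prox u - u‖ ^ 2 + σ * ⟪u - prox u, v - u⟫_ℝ +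
      σ / 2 * ‖(prox v - prox u) - (v - u)‖ ^ 2 ≤ val v + σ / 2 * ‖prox v - v‖ ^ 2 := by
    intro u v
    have h1 := hvi u (prox v)
    rw [hval, EReal.coe_le_coe_iff] at h1
    have h2 : prox v - v = ((prox v - prox u) - (v - u)) - (u - prox u) := by abel
    have h3 := norm_sub_sq_real ((prox v - prox u) - (v - u)) (u - prox u)
    rw [← h2, inner_sub_left, real_inner_comm, real_inner_comm (u - prox u) (v - u)] at h3
    rw [h3, norm_sub_rev (prox u) u]
    nlinarith
  have h1 := key u v
  have h2 := key v u
  rw [inner_smul_left]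
  simp only [conj_trivial]
  have e1 : ‖(prox v - prox u) - (v - u)‖ ^ 2 = ‖prox v - prox u‖ ^ 2
      - 2 * ⟪prox v - prox u, v - u⟫_ℝ + ‖v - u‖ ^ 2 := norm_sub_sq_real _ _
  have e2 : ‖(prox u - prox v) - (u - v)‖ ^ 2 = ‖(prox v - prox u) - (v - u)‖ ^ 2 := by
    rw [← norm_neg]; congr 2; abel
  have e3 : ⟪v - prox v, u - v⟫_ℝ = -⟪u - prox u, v - u⟫_ℝ + ⟪prox v - prox u, v - u⟫_ℝ
      - ‖v - u‖ ^ 2 := by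
    rw [← real_inner_self_eq_norm_sq, ← inner_neg_left, ← inner_add_left, ← inner_sub_left,
      ← neg_sub v u, inner_neg_right, ← inner_neg_left]
    congr 1
    abel
  rw [e2, e3] at h2
  have h4 : 0 ≤ ‖(prox v - prox u) - (v - u)‖ ^ 2 := by positivity
  have h5 : 0 ≤ ‖prox v - prox u‖ ^ 2 := by positivity
  rw [abs_le]
  constructor
  · nlinarith
  · rw [e1] at h2
    nlinarith

end MoreauEnvelope

/-! ### The proximal map of a piecewise linear-quadratic function -/

section ProximalMap

variable {E : Type*} [NormedAddCommGroup E] [InnerProductSpace ℝ E]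

/-- A stationary point `p` of `½⟨x, Q x⟩ + ⟨a, x⟩ + σ/2 ‖x - u‖²` on the affine subspace
`⟨n i, x⟩ = β i` depends affinely on `u`, provided `Q` is positive semidefinite along the subspace.
The proviso does not involve `u` or `p`; as a premise of the inner statement it makes the affine
map available without a case distinction. -/
theorem exists_affineMap_of_stationary [FiniteDimensional ℝ E] (Q : E →ₗ[ℝ] E) {σ : ℝ}
    (hσ : 0 < σ) {ι : Type*} (n : ι → E) (β : ι → ℝ) (a : E) :
    ∃ g : E →ᵃ[ℝ] E, ∀ u p : E, (∀ i, ⟪n i, p⟫_ℝ = β i) →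
      (∀ d, (∀ i, ⟪n i, d⟫_ℝ = 0) → ⟪Q p + a - σ • (u - p), d⟫_ℝ = 0) →
      (∀ d, (∀ i, ⟪n i, d⟫_ℝ = 0) → 0 ≤ ⟪Q d, d⟫_ℝ) → p = g u := by
  by_cases hne : ∃ u₀ p₀ : E, (∀ i, ⟪n i, p₀⟫_ℝ = β i) ∧
      (∀ d, (∀ i, ⟪n i, d⟫_ℝ = 0) → ⟪Q p₀ + a - σ • (u₀ - p₀), d⟫_ℝ = 0) ∧
      (∀ d, (∀ i, ⟪n i, d⟫_ℝ = 0) → 0 ≤ ⟪Q d, d⟫_ℝ)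
  swap
  · push Not at hne
    refine ⟨0, fun u p h1 h2 h3 => ?_⟩
    obtain ⟨d, hd, hlt⟩ := hne u p h1 h2
    exact absurd (h3 d hd) (not_le.2 hlt)
  obtain ⟨u₀, p₀, hp₀, hst₀, hpos⟩ := hne
  let V : Submodule ℝ E := ⨅ i, LinearMap.ker (innerSL ℝ (n i)).toLinearMap
  have hV : ∀ d, d ∈ V ↔ ∀ i, ⟪n i, d⟫_ℝ = 0 := fun d => by simp [V, Submodule.mem_iInf]
  have hproj : ∀ (x : E) (d : V), ⟪V.orthogonalProjectionOnto x, d⟫_ℝ = ⟪x, (d : E)⟫_ℝ :=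
    fun x d => V.inner_orthogonalProjectionOnto_eq_of_mem_right d x
  -- the compression of `Q + σ` to `V` is injective since `Q` is positive semidefinite on `V`
  let T : V →ₗ[ℝ] V :=
    V.orthogonalProjectionOnto.toLinearMap ∘ₗ (Q + σ • LinearMap.id) ∘ₗ V.subtype
  have hT : ∀ v d : V, ⟪T v, d⟫_ℝ = ⟪Q v + σ • (v : E), (d : E)⟫_ℝ := fun v d =>
    hproj (Q v + σ • (v : E)) d
  have hinj : Function.Injective T := by
    rw [← LinearMap.ker_eq_bot, LinearMap.ker_eq_bot']
    intro v hv
    have h1 := hT v v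
    rw [hv, inner_zero_left, inner_add_left, inner_smul_left, real_inner_self_eq_norm_sq] at h1
    have h2 := hpos v ((hV v).1 v.2)
    simp only [conj_trivial] at h1
    have h3 : ‖(v : E)‖ ^ 2 = 0 := by
      have : 0 ≤ ‖(v : E)‖ ^ 2 := by positivity
      nlinarith
    simpa using h3
  let T' : V ≃ₗ[ℝ] V := LinearEquiv.ofInjectiveEndo T hinj
  let L : E →ₗ[ℝ] E := V.subtype ∘ₗ T'.symm.toLinearMap ∘ₗ
    (σ • V.orthogonalProjectionOnto.toLinearMap)
  refine ⟨L.toAffineMap + AffineMap.const ℝ E (p₀ - L u₀), fun u p hp hst _ => ?_⟩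
  have hmem : p - p₀ ∈ V := (hV _).2 fun i => by rw [inner_sub_right, hp, hp₀, sub_self]
  have hTv : T ⟨p - p₀, hmem⟩ = σ • V.orthogonalProjectionOnto (u - u₀) := by
    refine ext_inner_right ℝ fun d => ?_
    have h1 := hst d ((hV d).1 d.2)
    have h2 := hst₀ d ((hV d).1 d.2)
    rw [hT, inner_smul_left, hproj]
    simp only [map_sub, inner_sub_left, inner_add_left, inner_smul_left, conj_trivial] at h1 h2 ⊢
    linarith
  have h3 : L u - L u₀ = p - p₀ := by
    rw [← map_sub]
    have h4 : T'.symm (σ • V.orthogonalProjectionOnto (u - u₀)) = ⟨p - p₀, hmem⟩ := by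
      rw [LinearEquiv.symm_apply_eq, ← hTv]; rfl
    exact congrArg Subtype.val h4
  have h5 : (L.toAffineMap + AffineMap.const ℝ E (p₀ - L u₀)) u = L u + (p₀ - L u₀) := rfl
  rw [h5, add_sub_left_comm, h3, add_sub_cancel]

/-- A piece `C k` containing `prox u` and its constraints active there determine the affine map:
along directions that keep these constraints active, `h` is the quadratic of the piece on both
sides of `prox u`, so the variational inequality forces stationarity and semidefiniteness. -/
theorem isPiecewiseAffine_prox [FiniteDimensional ℝ E] {h : E → EReal}
    (hplq : IsPiecewiseLinearQuadratic h) {σ : ℝ} (hσ : 0 < σ) {prox : E → E} {val : E → ℝ}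
    (hval : ∀ u, h (prox u) = val u)
    (hvi : ∀ u y, ((val u + σ * ⟪u - prox u, y - prox u⟫_ℝ : ℝ) : EReal) ≤ h y) :
    IsPiecewiseAffine prox := by
  obtain ⟨K, C, Q, a, α, hC, hQ, hdom, hq⟩ := hplq
  choose m n β hCeq using hC
  choose G hG using fun q : Σ k : Fin K, Set (Fin (m k)) =>
    exists_affineMap_of_stationary (Q q.1) hσ (fun i : q.2 => n q.1 i) (fun i => β q.1 i) (a q.1)
  refine ⟨(LipschitzWith.of_dist_le_mul (K := 1) fun u v => ?_).continuous, Set.range G,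
    Set.finite_range G, fun u => ?_⟩
  · simpa [dist_eq_norm] using norm_prox_sub_prox_le hσ hval hvi u v
  set p := prox u with hp
  obtain ⟨k, hk⟩ : ∃ k, p ∈ C k := by
    rw [← Set.mem_iUnion, ← hdom]
    change h p < ⊤
    rw [hval]
    exact EReal.coe_lt_top _
  let I : Set (Fin (m k)) := {i | ⟪n k i, p⟫_ℝ = β k i}
  refine ⟨_, ⟨⟨k, I⟩, rfl⟩, ?_⟩
  have hkp := hk
  rw [hCeq] at hkp
  -- the second-order expansion of `h` along a direction orthogonal to the active normals
  have hexp : ∀ d, (∀ i : I, ⟪n k i, d⟫_ℝ = 0) → ∃ ε > 0, ∀ t : ℝ, |t| < ε →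
      0 ≤ t * ⟪Q k p + a k - σ • (u - p), d⟫_ℝ + t ^ 2 * (1 / 2 * ⟪Q k d, d⟫_ℝ) := by
    intro d hd
    have hev : ∀ᶠ t : ℝ in nhds 0, ∀ i, ⟪n k i, p + t • d⟫_ℝ ≤ β k i := by
      rw [Filter.eventually_all]
      intro i
      by_cases hi : i ∈ I
      · refine Filter.Eventually.of_forall fun t => ?_
        rw [inner_add_right, inner_smul_right, hd ⟨i, hi⟩, mul_zero, add_zero]
        exact hkp i
      · have hlt : ⟪n k i, p⟫_ℝ < β k i := lt_of_le_of_ne (hkp i) hi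
        have hct : Continuous fun t : ℝ => ⟪n k i, p + t • d⟫_ℝ := by fun_prop
        have := hct.continuousAt (x := 0)
        filter_upwards [this.eventually_lt continuousAt_const (by simpa using hlt)] with t ht
        exact ht.le
    obtain ⟨ε, hε, hball⟩ := Metric.eventually_nhds_iff.1 hev
    refine ⟨ε, hε, fun t ht => ?_⟩
    have hmem : p + t • d ∈ C k := by
      rw [hCeq]; exact hball (by simpa using ht)
    have h1 := hvi u (p + t • d)
    have h2 := hq k p hk
    rw [hval, EReal.coe_eq_coe_iff] at h2
    rw [hq k _ hmem, EReal.coe_le_coe_iff, h2, ← hp] at h1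
    have hsym : ⟪p, Q k d⟫_ℝ = ⟪Q k p, d⟫_ℝ := (hQ k p d).symm
    simp only [map_add, map_smul, inner_add_left, inner_add_right, inner_smul_left,
      inner_smul_right, conj_trivial, add_sub_cancel_left, inner_sub_left, hsym,
      real_inner_comm (Q k p) d, real_inner_comm (Q k d) d] at h1 ⊢
    linarith
  refine hG ⟨k, I⟩ u p (fun i => i.2) (fun d hd => ?_) fun d hd => ?_
  · obtain ⟨ε, hε, H⟩ := hexp d hd
    have hscale : ∀ s : ℝ, |s| = 1 → 0 ≤ s * ⟪Q k p + a k - σ • (u - p), d⟫_ℝ := by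
      intro s hs
      suffices 0 ≤ (ε / 2) * (s * ⟪Q k p + a k - σ • (u - p), d⟫_ℝ) from
        nonneg_of_mul_nonneg_right this (by positivity)
      refine nonneg_of_forall_add_sq_nonneg (m := (ε / 2) ^ 2 * (1 / 2 * ⟪Q k d, d⟫_ℝ))
        fun t ht0 ht1 => ?_
      have h1 := H (t * (ε / 2) * s) (by
        rw [abs_mul, hs, abs_of_nonneg (by positivity)]; nlinarith)
      have hs2 : s ^ 2 = 1 := by rw [← sq_abs, hs, one_pow]
      rw [mul_pow _ s, hs2] at h1
      linarith
    have h1 := hscale 1 abs_one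
    have h2 := hscale (-1) (by simp)
    linarith
  · obtain ⟨ε, hε, H⟩ := hexp d hd
    have h1 := H (ε / 2) (by rw [abs_of_pos (by positivity)]; linarith)
    have h2 := H (-(ε / 2)) (by rw [abs_neg, abs_of_pos (by positivity)]; linarith)
    have h3 : 0 ≤ (ε / 2) ^ 2 * ⟪Q k d, d⟫_ℝ := by linarith
    exact nonneg_of_mul_nonneg_right h3 (by positivity)

/-- The Moreau envelope `e u = min_y h y + σ / 2 ‖y - u‖²` of a piecewise linear-quadratic
function: it is finite, the minimum is attained, and its gradient is piecewise affine. -/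
theorem exists_moreauEnvelope [FiniteDimensional ℝ E] {h : E → EReal}
    (hh : IsProperClosedConvex h) (hplq : IsPiecewiseLinearQuadratic h) {σ : ℝ} (hσ : 0 < σ) :
    ∃ e : E → ℝ, HasPiecewiseAffineGradient e ∧
      (∀ u y, ((e u - σ / 2 * ‖y - u‖ ^ 2 : ℝ) : EReal) ≤ h y) ∧
      ∀ u, ∃ y, h y = ((e u - σ / 2 * ‖y - u‖ ^ 2 : ℝ) : EReal) := by
  choose prox val hval hvi using fun u => hh.exists_prox hσ u
  refine ⟨fun u => val u + σ / 2 * ‖prox u - u‖ ^ 2,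
    ⟨_, hasFDerivAt_moreauEnvelope hσ hval hvi, ?_⟩, fun u y => ?_, fun u => ⟨prox u, ?_⟩⟩
  · have hprox := isPiecewiseAffine_prox hplq hσ hval hvi
    have h1 := (isPiecewiseAffine_affineMap (LinearMap.lsmul ℝ E σ).toAffineMap).add
      (hprox.affineMap_comp (LinearMap.lsmul ℝ E (-σ)).toAffineMap)
    convert! h1 using 2 with u
    simp [sub_eq_add_neg]
  · refine le_trans ?_ (hvi u y)
    beta_reduce
    rw [EReal.coe_le_coe_iff, show y - u = (y - prox u) - (u - prox u) by abel,
      norm_sub_sq_real (y - prox u), norm_sub_rev (prox u) u, real_inner_comm]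
    have := mul_nonneg hσ.le (sq_nonneg ‖y - prox u‖)
    linarith
  · rw [hval, add_sub_cancel_right]

end ProximalMap

/-! ### The reduced augmented Lagrangian and its residual -/

section Residual

variable {n₁ m : ℕ} {X₁ : Fin n₁ → Type*} {X₂ : Fin m → Type*} {Y : Type*}
  [∀ i, NormedAddCommGroup (X₁ i)] [∀ i, InnerProductSpace ℝ (X₁ i)]
  [∀ j, NormedAddCommGroup (X₂ j)] [∀ j, InnerProductSpace ℝ (X₂ j)]
  [NormedAddCommGroup Y] [InnerProductSpace ℝ Y]

/-- The inner minimization decouples into Moreau envelopes of the nonsmooth blocks. -/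
theorem Problem.reducedALE_eq (P : Problem X₁ X₂ Y) (σ : ℝ) {e₂ : ∀ j, X₂ j → ℝ} {en : Y → ℝ}
    (he₂ : ∀ j u y, ((e₂ j u - σ / 2 * ‖y - u‖ ^ 2 : ℝ) : EReal) ≤ P.h₂ j y)
    (he₂' : ∀ j u, ∃ y, P.h₂ j y = ((e₂ j u - σ / 2 * ‖y - u‖ ^ 2 : ℝ) : EReal))
    (hen : ∀ u y, ((en u - σ / 2 * ‖y - u‖ ^ 2 : ℝ) : EReal) ≤ P.hn y)
    (hen' : ∀ u, ∃ y, P.hn y = ((en u - σ / 2 * ‖y - u‖ ^ 2 : ℝ) : EReal))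
    (w : PrimalDualSpace X₁ X₂ Y) :
    P.reducedALE σ w = ((∑ i, P.h₁ i (w.fst.fst i) +
      ∑ j, e₂ j (w.fst.snd j - σ⁻¹ • w.snd.fst j) +
      en (P.b - P.linPart w.fst - σ⁻¹ • w.snd.snd) + -(1 / (2 * σ)) * ‖w.snd‖ ^ 2 : ℝ) : EReal) := by
  set v : ∀ j, X₂ j := fun j => w.fst.snd j - σ⁻¹ • w.snd.fst j with hv
  set u : Y := P.b - P.linPart w.fst - σ⁻¹ • w.snd.snd with hu
  have hnorm : ‖w.snd‖ ^ 2 = ∑ j, ‖w.snd.fst j‖ ^ 2 + ‖w.snd.snd‖ ^ 2 := by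
    rw [WithLp.prod_norm_sq_eq_of_L2, PiLp.norm_sq_eq_of_L2]
  have hY : ∀ xn : Y, P.linPart w.fst + xn - P.b + σ⁻¹ • w.snd.snd = xn - u := fun xn => by
    rw [hu]; abel
  have hX : ∀ (y : PiLp 2 X₂) j, w.fst.snd j - y j - σ⁻¹ • w.snd.fst j = -(y j - v j) :=
    fun y j => by simp only [hv, neg_sub]; exact sub_right_comm _ _ _
  have hreal : ∀ (y : PiLp 2 X₂) (xn : Y),
      ((∑ i, P.h₁ i (w.fst.fst i) + ∑ j, e₂ j (v j) + en u + -(1 / (2 * σ)) * ‖w.snd‖ ^ 2 : ℝ)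
        : EReal) = ((∑ i, P.h₁ i (w.fst.fst i) : ℝ) : EReal) +
        ∑ j, ((e₂ j (v j) - σ / 2 * ‖y j - v j‖ ^ 2 : ℝ) : EReal) +
        ((en u - σ / 2 * ‖xn - u‖ ^ 2 : ℝ) : EReal) +
        ((-(1 / (2 * σ)) * (∑ j, ‖w.snd.fst j‖ ^ 2 + ‖w.snd.snd‖ ^ 2)
          + σ / 2 * ‖P.linPart w.fst + xn - P.b + σ⁻¹ • w.snd.snd‖ ^ 2
          + σ / 2 * ∑ j, ‖w.fst.snd j - y j - σ⁻¹ • w.snd.fst j‖ ^ 2 : ℝ) : EReal) := by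
    intro y xn
    have hcoe : ∑ j, ((e₂ j (v j) - σ / 2 * ‖y j - v j‖ ^ 2 : ℝ) : EReal) =
        ((∑ j, (e₂ j (v j) - σ / 2 * ‖y j - v j‖ ^ 2) : ℝ) : EReal) :=
      (map_sum (⟨⟨Real.toEReal, EReal.coe_zero⟩, EReal.coe_add⟩ : ℝ →+ EReal) _ _).symm
    rw [hcoe, ← EReal.coe_add, ← EReal.coe_add, ← EReal.coe_add, hnorm, hY]
    simp only [hX, norm_neg]
    rw [Finset.sum_sub_distrib, ← Finset.mul_sum]
    congr 1
    ring
  apply le_antisymm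
  · choose y hy using fun j => he₂' j (v j)
    obtain ⟨xn, hxn⟩ := hen' u
    refine (iInf₂_le (WithLp.toLp 2 y) xn).trans (le_of_eq ?_)
    rw [hreal (WithLp.toLp 2 y) xn, Problem.augLagrangian, hxn]
    congr 3
    exact Finset.sum_congr rfl fun j _ => hy j
  · refine le_iInf₂ fun y xn => ?_
    rw [hreal y xn, Problem.augLagrangian]
    gcongr
    · exact he₂ _ _ _
    · exact hen _ _

variable [∀ i, FiniteDimensional ℝ (X₁ i)] [∀ j, FiniteDimensional ℝ (X₂ j)]
  [FiniteDimensional ℝ Y]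

/-- Partial gradients are the components of the gradient, so the residual is the gradient followed
by the sign change `(x, z) ↦ (x, -z)`. -/
theorem Problem.isPiecewiseAffine_residual (P : Problem X₁ X₂ Y) (σ : ℝ)
    (hΦ : HasPiecewiseAffineGradient (P.Phi σ)) : IsPiecewiseAffine (P.residual σ) := by
  obtain ⟨g, hg, hga⟩ := hΦ
  have : CompleteSpace (PrimalSpace X₁ X₂) := FiniteDimensional.complete ℝ _
  have : CompleteSpace (DualSpace X₂ Y) := FiniteDimensional.complete ℝ _
  let ip : PrimalSpace X₁ X₂ →L[ℝ] PrimalDualSpace X₁ X₂ Y :=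
    (WithLp.prodContinuousLinearEquiv 2 ℝ _ _).symm.toContinuousLinearMap ∘L
      ContinuousLinearMap.inl ℝ _ _
  let iq : DualSpace X₂ Y →L[ℝ] PrimalDualSpace X₁ X₂ Y :=
    (WithLp.prodContinuousLinearEquiv 2 ℝ _ _).symm.toContinuousLinearMap ∘L
      ContinuousLinearMap.inr ℝ _ _
  have hX : ∀ w, P.gradX σ w = (g w).fst := by
    intro w
    refine HasGradientAt.gradient ?_
    rw [hasGradientAt_iff_hasFDerivAt]
    have hi : HasFDerivAt (fun x : PrimalSpace X₁ X₂ =>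
        (WithLp.toLp 2 (x, w.snd) : PrimalDualSpace X₁ X₂ Y)) ip w.fst := by
      have h1 := ip.hasFDerivAt (x := w.fst) |>.add_const (iq w.snd)
      convert! h1 using 2 with x
      exact WithLp.ofLp_injective 2 (Prod.ext (by simp [ip, iq]) (by simp [ip, iq]))
    convert! (hg w).comp w.fst hi using 1
    ext x
    simp [ip, WithLp.prod_inner_apply]
  have hZ : ∀ w, P.gradZ σ w = (g w).snd := by
    intro w
    refine HasGradientAt.gradient ?_
    rw [hasGradientAt_iff_hasFDerivAt]
    have hi : HasFDerivAt (fun z : DualSpace X₂ Y =>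
        (WithLp.toLp 2 (w.fst, z) : PrimalDualSpace X₁ X₂ Y)) iq w.snd := by
      have h1 := iq.hasFDerivAt (x := w.snd) |>.const_add (ip w.fst)
      convert! h1 using 2 with z
      exact WithLp.ofLp_injective 2 (Prod.ext (by simp [ip, iq]) (by simp [ip, iq]))
    convert! (hg w).comp w.snd hi using 1
    ext z
    simp [iq, WithLp.prod_inner_apply]
  let J : PrimalDualSpace X₁ X₂ Y →ₗ[ℝ] PrimalDualSpace X₁ X₂ Y :=
    (WithLp.linearEquiv 2 ℝ _).symm.toLinearMap ∘ₗ
      (LinearMap.id.prodMap (-LinearMap.id)) ∘ₗ (WithLp.linearEquiv 2 ℝ _).toLinearMap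
  convert! hga.affineMap_comp J.toAffineMap using 2 with w
  rw [Problem.residual, hX, hZ]
  rfl

/-- The reduced function is a sum of the smooth functions, Moreau envelopes and a quadratic, each
composed with an affine map. -/
theorem Problem.exists_reducedALE_eq_coe (P : Problem X₁ X₂ Y) {σ : ℝ} (hσ : 0 < σ)
    (h₁_smooth : ∀ i, ContDiff ℝ 1 (P.h₁ i))
    (h₁_plq : ∀ i, IsPiecewiseLinearQuadratic (fun x => ((P.h₁ i x : ℝ) : EReal)))
    (h₂_pcc : ∀ j, IsProperClosedConvex (P.h₂ j))
    (h₂_plq : ∀ j, IsPiecewiseLinearQuadratic (P.h₂ j))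
    (hn_pcc : IsProperClosedConvex P.hn) (hn_plq : IsPiecewiseLinearQuadratic P.hn) :
    ∃ Φ : PrimalDualSpace X₁ X₂ Y → ℝ, HasPiecewiseAffineGradient Φ ∧
      ∀ w, P.reducedALE σ w = ((Φ w : ℝ) : EReal) := by
  choose e₂ he₂ he₂_le he₂_eq using fun j => exists_moreauEnvelope (h₂_pcc j) (h₂_plq j) hσ
  obtain ⟨en, hen, hen_le, hen_eq⟩ := exists_moreauEnvelope hn_pcc hn_plq hσ
  -- the coordinate projections of `w = (x, z)`
  let πx : PrimalDualSpace X₁ X₂ Y →ₗ[ℝ] PrimalSpace X₁ X₂ :=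
    LinearMap.fst ℝ _ _ ∘ₗ (WithLp.linearEquiv 2 ℝ _).toLinearMap
  let πz : PrimalDualSpace X₁ X₂ Y →ₗ[ℝ] DualSpace X₂ Y :=
    LinearMap.snd ℝ _ _ ∘ₗ (WithLp.linearEquiv 2 ℝ _).toLinearMap
  let πx₁ : ∀ i, PrimalDualSpace X₁ X₂ Y →ₗ[ℝ] X₁ i := fun i =>
    (PiLp.proj 2 X₁ i).toLinearMap ∘ₗ LinearMap.fst ℝ _ _ ∘ₗ
      (WithLp.linearEquiv 2 ℝ _).toLinearMap ∘ₗ πx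
  let πx₂ : ∀ j, PrimalDualSpace X₁ X₂ Y →ₗ[ℝ] X₂ j := fun j =>
    (PiLp.proj 2 X₂ j).toLinearMap ∘ₗ LinearMap.snd ℝ _ _ ∘ₗ
      (WithLp.linearEquiv 2 ℝ _).toLinearMap ∘ₗ πx
  let πz₂ : ∀ j, PrimalDualSpace X₁ X₂ Y →ₗ[ℝ] X₂ j := fun j =>
    (PiLp.proj 2 X₂ j).toLinearMap ∘ₗ LinearMap.fst ℝ _ _ ∘ₗ
      (WithLp.linearEquiv 2 ℝ _).toLinearMap ∘ₗ πz
  let πzn : PrimalDualSpace X₁ X₂ Y →ₗ[ℝ] Y :=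
    LinearMap.snd ℝ _ _ ∘ₗ (WithLp.linearEquiv 2 ℝ _).toLinearMap ∘ₗ πz
  have h1 := HasPiecewiseAffineGradient.sum Finset.univ fun i _ =>
    (hasPiecewiseAffineGradient_of_plq (h₁_smooth i)
      (h₁_plq i)).comp_affine (πx₁ i) 0
  have h2 := HasPiecewiseAffineGradient.sum Finset.univ fun j _ =>
    (he₂ j).comp_affine (πx₂ j - σ⁻¹ • πz₂ j) 0
  have h3 := hen.comp_affine
    (-(∑ i, P.A₁ i ∘ₗ πx₁ i + ∑ j, P.A₂ j ∘ₗ πx₂ j) - σ⁻¹ • πzn) P.b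
  have h4 := (hasPiecewiseAffineGradient_const_mul_norm_sq (E := DualSpace X₂ Y)
    (-(1 / (2 * σ)))).comp_affine πz 0
  refine ⟨_, ((h1.add h2).add h3).add h4, fun w => ?_⟩
  rw [P.reducedALE_eq σ he₂_le he₂_eq hen_le hen_eq w, EReal.coe_eq_coe_iff]
  have e3 : P.b - P.linPart w.fst - σ⁻¹ • w.snd.snd =
      (-(∑ i, P.A₁ i ∘ₗ πx₁ i + ∑ j, P.A₂ j ∘ₗ πx₂ j) - σ⁻¹ • πzn) w + P.b := by
    simp only [Problem.linPart, πx₁, πx₂, πzn, πx, πz]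
    simp
    abel
  rw [e3]
  simp [πx₁, πx₂, πz₂, πx, πz]

end Residual
end ConvexComposite

theorem mainTheorem5 {n₁ m : ℕ} {X₁ : Fin n₁ → Type*} {X₂ : Fin m → Type*} {Y : Type*}
    [∀ i, NormedAddCommGroup (X₁ i)] [∀ i, InnerProductSpace ℝ (X₁ i)]
    [∀ i, FiniteDimensional ℝ (X₁ i)]
    [∀ j, NormedAddCommGroup (X₂ j)] [∀ j, InnerProductSpace ℝ (X₂ j)]
    [∀ j, FiniteDimensional ℝ (X₂ j)]
    [NormedAddCommGroup Y] [InnerProductSpace ℝ Y] [FiniteDimensional ℝ Y]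
    (P : ConvexComposite.Problem X₁ X₂ Y) (σ : ℝ) (hσ : 0 < σ)
    -- the smooth blocks: convex, twice continuously differentiable, Lipschitz gradient
    (h₁_convex : ∀ i, ConvexOn ℝ Set.univ (P.h₁ i))
    (h₁_smooth : ∀ i, ContDiff ℝ 2 (P.h₁ i))
    (h₁_lipschitz : ∀ i, ∃ L : NNReal, LipschitzWith L (fderiv ℝ (P.h₁ i)))
    -- the nonsmooth blocks: proper, closed, convex
    (h₂_pcc : ∀ j, ConvexComposite.IsProperClosedConvex (P.h₂ j))
    (hn_pcc : ConvexComposite.IsProperClosedConvex P.hn)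
    -- all blocks are piecewise linear-quadratic
    (h₁_plq : ∀ i, ConvexComposite.IsPiecewiseLinearQuadratic
      (fun x => ((P.h₁ i x : ℝ) : EReal)))
    (h₂_plq : ∀ j, ConvexComposite.IsPiecewiseLinearQuadratic (P.h₂ j))
    (hn_plq : ConvexComposite.IsPiecewiseLinearQuadratic P.hn) :
    -- `Φ` is finite and differentiable, so that `F` is well defined
    (∀ w, P.reducedALE σ w ≠ ⊥ ∧ P.reducedALE σ w ≠ ⊤) ∧
    Differentiable ℝ (P.Phi σ) ∧
    -- the local error bound for `F`
    ConvexComposite.LocalErrorBound (P.residual σ) := by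
  obtain ⟨Φ, hΦ, hred⟩ := P.exists_reducedALE_eq_coe hσ
    (fun i => (h₁_smooth i).of_le one_le_two) h₁_plq h₂_pcc h₂_plq hn_pcc hn_plq
  have hPhi : P.Phi σ = Φ := funext fun w => by
    rw [ConvexComposite.Problem.Phi, hred, EReal.toReal_coe]
  refine ⟨fun w => ?_, fun w => ?_,
    (P.isPiecewiseAffine_residual σ (hPhi ▸ hΦ)).localErrorBound⟩
  · rw [hred]
    exact ⟨EReal.coe_ne_bot _, EReal.coe_ne_top _⟩
  · obtain ⟨g, hg, -⟩ := hΦ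
    rw [hPhi]
    exact (hg w).differentiableAt
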